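/- Let $P\subset\mathbb{R}^n$ be a convex $m$-polytope, that is, the convex hull of a nonempty finite set of points whose affine span has dimension $m$. Call a set $X\subset\mathbb{R}^n$ centrally symmetric if there is a point $c\in\mathbb{R}^n$ with $X=\{2c-x : x\in X\}$. A face of $P$ is a nonempty set of the form $\{x\in P : \ell(x)=\max_P \ell\}$ with $\ell$ a linear functional on $\mathbb{R}^n$ (so $P$ itself is a face, with $\ell=0$), and a $2$-face is a face whose affine span has dimension $2$. If all $2$-faces of $P$ are centrally symmetric, then $P$ is a zonotope, i.e. a Minkowski sum of finitely many line segments: there exist $k\ge 0$ and $v,a_1,\dots,a_k\in\mathbb{R}^n$ such that $$P=v+\Big\{\sum_{i=1}^k t_i a_i \;:\; 0\le t_i\le 1 \text{ for all } i\Big\}.$$ -/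

import Mathlib

/-- The reflection `2c - X` of a set `X` in a point `c`. -/
def pointReflectionImage {n : ℕ} (c : EuclideanSpace ℝ (Fin n))
    (X : Set (EuclideanSpace ℝ (Fin n))) : Set (EuclideanSpace ℝ (Fin n)) :=
  {y | ∃ x ∈ X, y = (2 : ℝ) • c - x}

/-- `X` is centrally symmetric: it equals its reflection in some point. -/
def IsCentrallySymmetric {n : ℕ} (X : Set (EuclideanSpace ℝ (Fin n))) : Prop :=
  ∃ c : EuclideanSpace ℝ (Fin n), X = pointReflectionImage c X

/-- A (nonempty) convex polytope: the convex hull of a nonempty finite set of points. -/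
def IsConvexPolytope {n : ℕ} (P : Set (EuclideanSpace ℝ (Fin n))) : Prop :=
  ∃ S : Set (EuclideanSpace ℝ (Fin n)), S.Finite ∧ S.Nonempty ∧ P = convexHull ℝ S

/-- The dimension of the affine span of `X` (used for nonempty `X`; it is `0` for the empty set). -/
noncomputable def affineDim {n : ℕ} (X : Set (EuclideanSpace ℝ (Fin n))) : ℕ :=
  Module.finrank ℝ (vectorSpan ℝ X)

/-- `F` is a `k`-dimensional face of `P`: a nonempty set of dimension `k` consisting of all points
of `P` at which some linear functional attains its maximum over `P`. The zero functional is allowed,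
so that `P` is a face of itself. -/
def IsFaceOfDim {n : ℕ} (k : ℕ) (P F : Set (EuclideanSpace ℝ (Fin n))) : Prop :=
  F.Nonempty ∧ IsExposed ℝ P F ∧ affineDim F = k

/-- The set `{∑ tᵢ aᵢ | 0 ≤ tᵢ ≤ 1}`, i.e. the image of the unit cube of `ℝᵏ` under the linear map
whose matrix has the columns `aᵢ`, or the Minkowski sum of the segments from `0` to `aᵢ`. -/
def zonotopeGeneratedBy {n k : ℕ} (a : Fin k → EuclideanSpace ℝ (Fin n)) :
    Set (EuclideanSpace ℝ (Fin n)) :=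
  {x | ∃ t : Fin k → ℝ, (∀ i, 0 ≤ t i ∧ t i ≤ 1) ∧ x = ∑ i, t i • a i}

/-- `P` is a zonotope, wherever it is positioned: a translate of a set `{∑ tᵢ aᵢ | 0 ≤ tᵢ ≤ 1}`.
Since a translation may be absorbed into one of the summands (or into a degenerate one), these are
the Minkowski sums of finitely many line segments. -/
def IsZonotope {n : ℕ} (P : Set (EuclideanSpace ℝ (Fin n))) : Prop :=
  ∃ (k : ℕ) (a : Fin k → EuclideanSpace ℝ (Fin n)) (v : EuclideanSpace ℝ (Fin n)),
    P = {y | ∃ x ∈ zonotopeGeneratedBy a, y = v + x}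

/-! Write `P = conv S` and let `R` contain one unit vector for each direction of a difference of
points of `S`. Call `u ⟂ e` generic if no other member of `R` is orthogonal to `u`; the face of `P`
in such a direction is a segment parallel to `e`, or a point.

The length of this face does not depend on the generic `u` (`diam_maxFace_eq`). Two generic vectors
can be joined, after a small perturbation, by a line in `e^⊥` along which the face never spans more
than a plane containing `e`. If it spans such a plane, it is a centrally symmetric 2-face, so its
opposite edges, which are the faces just before and just after, are equally long. This gives one
length `c e` for each `e`.

Along a generic line the slope of the support function of `P` jumps exactly where the line meets
some `e^⊥`, by the length `c e` times `|⟪e, w⟫|`, where `w` is the direction of the line. The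
function `½ ∑ c e |⟪e, ·⟫|` has the same jumps (`supportFn_sub_abs_locally_affine`). The difference
is therefore affine on generic lines, hence by continuity satisfies Jensen's equation and is linear.
So `P` has the support function of a zonotope, and Hahn-Banach identifies the two bodies. -/

open Filter Topology

/-! ### Faces in a given direction and their behaviour under perturbation -/

variable {E : Type*} [NormedAddCommGroup E] [InnerProductSpace ℝ E]

/-- The set of points of `X` at which the functional `⟪·, u⟫` is maximal. -/
def maxFace (X : Set E) (u : E) : Set E :=
  {x ∈ X | ∀ y ∈ X, inner ℝ y u ≤ inner ℝ x u}

theorem maxFace_subset (X : Set E) (u : E) : maxFace X u ⊆ X := fun _ h => h.1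

theorem inner_eq_of_mem_maxFace {X : Set E} {u x y : E} (hx : x ∈ maxFace X u)
    (hy : y ∈ maxFace X u) : inner ℝ x u = inner ℝ y u :=
  le_antisymm (hy.2 x hx.1) (hx.2 y hy.1)

theorem maxFace_eq_self {X : Set E} {u : E} (h : ∀ x ∈ X, ∀ y ∈ X, inner ℝ (x - y) u = 0) :
    maxFace X u = X := by
  refine (maxFace_subset X u).antisymm fun x hx => ⟨hx, fun y hy => ?_⟩
  have := h y hy x hx
  rw [inner_sub_left] at this
  linarith

theorem maxFace_nonempty {X : Set E} (hX : IsCompact X) (hne : X.Nonempty) (u : E) :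
    (maxFace X u).Nonempty := by
  obtain ⟨x, hx, h⟩ := hX.exists_isMaxOn hne (f := fun x => inner ℝ x u) (by fun_prop)
  exact ⟨x, hx, h⟩

theorem convex_maxFace {X : Set E} (hX : Convex ℝ X) (u : E) : Convex ℝ (maxFace X u) := by
  intro x hx y hy a b ha hb hab
  refine ⟨hX hx.1 hy.1 ha hb hab, fun z hz => ?_⟩
  have h1 := hx.2 z hz
  have h2 := hy.2 z hz
  rw [inner_add_left, real_inner_smul_left, real_inner_smul_left]
  calc inner ℝ z u = a * inner ℝ z u + b * inner ℝ z u := by rw [← add_mul, hab, one_mul]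
    _ ≤ _ := by gcongr

theorem inner_le_of_mem_convexHull {S : Set E} {u : E} {M : ℝ} (h : ∀ y ∈ S, inner ℝ y u ≤ M)
    {x : E} (hx : x ∈ convexHull ℝ S) : inner ℝ x u ≤ M := by
  have hc : Convex ℝ {x : E | inner ℝ x u ≤ M} := by
    intro x hx y hy a b ha hb hab
    simp only [Set.mem_ofPred_eq] at *
    rw [inner_add_left, real_inner_smul_left, real_inner_smul_left]
    calc _ ≤ a * M + b * M := by gcongr
      _ = M := by rw [← add_mul, hab, one_mul]
  exact convexHull_min h hc hx

/-- An average equals the maximum of the averaged values only if every point of nonzero weight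
attains it. -/
theorem maxFace_convexHull (S : Finset E) (u : E) :
    maxFace (convexHull ℝ (S : Set E)) u = convexHull ℝ (maxFace (S : Set E) u) := by
  apply Set.Subset.antisymm
  · rintro x ⟨hx, hmax⟩
    rw [Finset.mem_convexHull'] at hx
    obtain ⟨w, hw0, hw1, rfl⟩ := hx
    set x := ∑ y ∈ S, w y • y with hxdef
    have hle : ∀ s ∈ S, inner ℝ s u ≤ inner ℝ x u := fun s hs =>
      hmax s (subset_convexHull ℝ _ hs)
    have hsum : ∑ s ∈ S, w s * (inner ℝ x u - inner ℝ s u) = 0 := by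
      simp only [mul_sub, Finset.sum_sub_distrib, ← Finset.sum_mul, hw1, one_mul]
      rw [hxdef, sum_inner, sub_eq_zero]
      simp [real_inner_smul_left]
    have hz := (Finset.sum_eq_zero_iff_of_nonneg
      (fun s hs => mul_nonneg (hw0 s hs) (sub_nonneg.2 (hle s hs)))).1 hsum
    have hx' : x = S.centerMass w id := by
      rw [Finset.centerMass_eq_of_sum_1 _ _ hw1]; rfl
    rw [hx', ← Finset.centerMass_filter_ne_zero]
    refine Finset.centerMass_mem_convexHull _ (fun s hs => hw0 s (Finset.mem_filter.1 hs).1) ?_ ?_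
    · rw [Finset.sum_filter_ne_zero, hw1]; exact one_pos
    · intro s hs
      obtain ⟨hs, hne⟩ := Finset.mem_filter.1 hs
      have := (mul_eq_zero.1 (hz s hs)).resolve_left hne
      exact ⟨hs, fun y hy => (hle y hy).trans (sub_eq_zero.1 this).le⟩
  · refine convexHull_min ?_ (convex_maxFace (convex_convexHull ℝ _) u)
    rintro x ⟨hx, h⟩
    exact ⟨subset_convexHull ℝ _ hx, fun y hy => inner_le_of_mem_convexHull h hy⟩

/-- The finitely many strict inequalities between values of `⟪·, u⟫` survive a small perturbation,
so `w` only breaks the ties. -/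
theorem maxFace_add_smul_of_finite {S : Set E} (hS : S.Finite) (u w : E) :
    ∀ᶠ t : ℝ in 𝓝[>] 0, maxFace S (u + t • w) = maxFace (maxFace S u) w := by
  have key : ∀ᶠ t : ℝ in 𝓝[>] 0, ∀ x ∈ S, ∀ y ∈ S, inner ℝ x u < inner ℝ y u →
      inner ℝ x (u + t • w) < inner ℝ y (u + t • w) := by
    rw [hS.eventually_all]
    intro x _
    rw [hS.eventually_all]
    intro y _
    rw [eventually_imp_distrib_left]
    intro h
    refine nhdsWithin_le_nhds ?_
    have c : ∀ z : E, Continuous fun t : ℝ => inner ℝ z (u + t • w) := fun z => by fun_prop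
    exact (c x).continuousAt.eventually_lt (c y).continuousAt (by simpa using h)
  filter_upwards [key, self_mem_nhdsWithin] with t ht (ht0 : 0 < t)
  have hin : ∀ z : E, inner ℝ z (u + t • w) = inner ℝ z u + t * inner ℝ z w := fun z => by
    rw [inner_add_right, real_inner_smul_right]
  ext x
  constructor
  · rintro ⟨hx, h⟩
    have hxu : x ∈ maxFace S u := by
      refine ⟨hx, fun y hy => ?_⟩
      by_contra! hlt
      exact absurd (ht x hx y hy hlt) (not_lt.2 (h y hy))
    refine ⟨hxu, fun y hy => ?_⟩
    have h1 := h y hy.1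
    rw [hin, hin, inner_eq_of_mem_maxFace hy hxu] at h1
    exact le_of_mul_le_mul_left (by linarith) ht0
  · rintro ⟨hx, h⟩
    refine ⟨hx.1, fun y hy => ?_⟩
    by_cases hyu : y ∈ maxFace S u
    · have h1 := h y hyu
      rw [hin, hin, inner_eq_of_mem_maxFace hyu hx]
      gcongr
    · have : inner ℝ y u < inner ℝ x u := by
        refine lt_of_le_of_ne (hx.2 y hy) fun he => hyu ⟨hy, fun z hz => ?_⟩
        rw [he]; exact hx.2 z hz
      exact (ht y hy x hx.1 this).le

theorem maxFace_add_smul (S : Finset E) (u w : E) :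
    ∀ᶠ t : ℝ in 𝓝[>] 0, maxFace (convexHull ℝ (S : Set E)) (u + t • w) =
      maxFace (maxFace (convexHull ℝ (S : Set E)) u) w := by
  filter_upwards [maxFace_add_smul_of_finite S.finite_toSet u w] with t ht
  rw [maxFace_convexHull, ht, maxFace_convexHull]
  have hf : (maxFace (S : Set E) u).Finite := S.finite_toSet.subset (maxFace_subset _ _)
  have := maxFace_convexHull hf.toFinset w
  rw [hf.coe_toFinset] at this
  rw [this]

/-- Just after `t`, the face in direction `u + t' • w` is the face of the face at `t`. -/
theorem maxFace_line_gt (S : Finset E) (u w : E) (t : ℝ) :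
    ∀ᶠ t' in 𝓝[>] t, maxFace (convexHull ℝ (S : Set E)) (u + t' • w) =
      maxFace (maxFace (convexHull ℝ (S : Set E)) (u + t • w)) w := by
  have h := maxFace_add_smul S (u + t • w) w
  have hm : Tendsto (fun t' => t' - t) (𝓝[>] t) (𝓝[>] 0) := by
    refine tendsto_nhdsWithin_iff.2 ⟨?_, ?_⟩
    · refine tendsto_nhdsWithin_of_tendsto_nhds ?_
      simpa using (by fun_prop : Continuous fun t' : ℝ => t' - t).tendsto t
    · filter_upwards [self_mem_nhdsWithin] with t' (h : t < t')
      simpa using h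
  filter_upwards [hm.eventually h] with t' ht'
  rw [← ht']
  congr 1
  module

theorem maxFace_line_lt (S : Finset E) (u w : E) (t : ℝ) :
    ∀ᶠ t' in 𝓝[<] t, maxFace (convexHull ℝ (S : Set E)) (u + t' • w) =
      maxFace (maxFace (convexHull ℝ (S : Set E)) (u + t • w)) (-w) := by
  have h := maxFace_add_smul S (u + t • w) (-w)
  have hm : Tendsto (fun t' => t - t') (𝓝[<] t) (𝓝[>] 0) := by
    refine tendsto_nhdsWithin_iff.2 ⟨?_, ?_⟩
    · refine tendsto_nhdsWithin_of_tendsto_nhds ?_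
      simpa using (by fun_prop : Continuous fun t' : ℝ => t - t').tendsto t
    · filter_upwards [self_mem_nhdsWithin] with t' (h : t' < t)
      simpa using h
  filter_upwards [hm.eventually h] with t' ht'
  rw [← ht']
  congr 1
  module

/-! ### Directions, generic vectors, and criteria for linearity -/

/-- Unit vectors representing, once each, all directions of a finite set of vectors. -/
theorem exists_direction_representatives (D : Finset E) :
    ∃ R : Finset E, (∀ e ∈ R, ‖e‖ = 1) ∧ (∀ e ∈ R, ∀ f ∈ R, ∀ a : ℝ, e = a • f → e = f) ∧
      ∀ d ∈ D, d ≠ 0 → ∃ e ∈ R, ∃ a : ℝ, d = a • e := by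
  classical
  induction D using Finset.induction_on with
  | empty => exact ⟨∅, by simp, by simp, by simp⟩
  | insert d D _ ih =>
    obtain ⟨R, h1, h2, h3⟩ := ih
    by_cases hd : d = 0 ∨ ∃ e ∈ R, ∃ a : ℝ, d = a • e
    · refine ⟨R, h1, h2, fun d' hd' hne => ?_⟩
      rcases Finset.mem_insert.1 hd' with rfl | h
      · exact hd.resolve_left hne
      · exact h3 d' h hne
    · push Not at hd
      obtain ⟨hd0, hd⟩ := hd
      have hn : ‖d‖ ≠ 0 := norm_ne_zero_iff.2 hd0
      have hdd : d = ‖d‖ • (‖d‖⁻¹ • d) := by rw [smul_smul, mul_inv_cancel₀ hn, one_smul]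
      refine ⟨insert (‖d‖⁻¹ • d) R, ?_, ?_, ?_⟩
      · intro e he
        rcases Finset.mem_insert.1 he with rfl | h
        · rw [norm_smul, norm_inv, norm_norm, inv_mul_cancel₀ hn]
        · exact h1 e h
      · intro e he f hf a hef
        rcases Finset.mem_insert.1 he with rfl | he <;> rcases Finset.mem_insert.1 hf with rfl | hf
        · rfl
        · exact absurd (by rw [mul_smul, ← hef]; exact hdd) (hd f hf (‖d‖ * a))
        · have ha : a ≠ 0 := by
            rintro rfl
            have := h1 e he
            simp [hef] at this
          refine absurd ?_ (hd e he (‖d‖ * a⁻¹))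
          rw [hef, smul_smul, mul_assoc, inv_mul_cancel₀ ha, mul_one, ← hdd]
        · exact h2 e he f hf a hef
      · intro d' hd' hne
        rcases Finset.mem_insert.1 hd' with rfl | h
        · exact ⟨_, Finset.mem_insert_self _ _, _, hdd⟩
        · obtain ⟨e, he, h⟩ := h3 d' h hne
          exact ⟨e, Finset.mem_insert_of_mem he, h⟩

/-- The complement of each hyperplane `v^⊥` is open, and dense because `w + t • v` lies in `v^⊥` for
only one `t`; finitely many open dense sets have dense intersection. -/
theorem dense_inner_ne_zero (T : Finset E) (hT : ∀ v ∈ T, v ≠ 0) :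
    Dense {w : E | ∀ v ∈ T, inner ℝ v w ≠ 0} := by
  classical
  have ho : ∀ v : E, IsOpen {w : E | inner ℝ v w ≠ 0} := fun v =>
    isOpen_ne_fun (by fun_prop) (by fun_prop)
  have hd : ∀ v : E, v ≠ 0 → Dense {w : E | inner ℝ v w ≠ 0} := by
    intro v hv w
    have ht : Tendsto (fun t : ℝ => w + t • v) (𝓝[≠] 0) (𝓝 w) := by
      refine tendsto_nhdsWithin_of_tendsto_nhds ?_
      simpa using (by fun_prop : Continuous fun t : ℝ => w + t • v).tendsto 0
    refine mem_closure_of_tendsto ht ?_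
    have hv2 : inner ℝ v v ≠ 0 := inner_self_ne_zero.2 hv
    have : ∀ᶠ t in 𝓝[≠] (0 : ℝ), t ≠ - inner ℝ v w / inner ℝ v v :=
      nhdsNE_le_cofinite 0 ((Set.finite_singleton _).eventually_cofinite_notMem)
    filter_upwards [this] with t ht h0
    apply ht
    simp only [inner_add_right, real_inner_smul_right] at h0
    field_simp
    linarith
  induction T using Finset.induction_on with
  | empty => simp
  | insert v T _ ih =>
    have := (hd v (hT v (by simp))).inter_of_isOpen_left
      (ih fun v hv => hT v (Finset.mem_insert_of_mem hv)) (ho v)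
    convert this using 1
    ext w
    simp

/-- A function of a real variable which is affine near every point is affine. -/
theorem affine_of_locally_affine {ψ : ℝ → ℝ}
    (h : ∀ t, ∃ b, ∀ᶠ t' in 𝓝 t, ψ t' = ψ t + b * (t' - t)) :
    ∃ b, ∀ t, ψ t = ψ 0 + b * t := by
  choose b hb using h
  have hder : ∀ t, ∀ᶠ t' in 𝓝 t, HasDerivAt ψ (b t) t' := by
    intro t
    filter_upwards [(hb t).eventually_nhds] with t' ht'
    have : HasDerivAt (fun s => ψ t + b t * (s - t)) (b t) t' := by
      simpa using (((hasDerivAt_id t').sub_const t).const_mul (b t)).const_add (ψ t)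
    exact this.congr_of_eventuallyEq ht'
  have hloc : IsLocallyConstant b := by
    rw [IsLocallyConstant.iff_eventually_eq]
    intro t
    filter_upwards [hder t] with t' ht'
    exact (hder t').self_of_nhds.unique ht'
  refine ⟨b 0, fun t => ?_⟩
  have hd : ∀ s, HasDerivAt (fun s => ψ s - b 0 * s) 0 s := by
    intro s
    have h1 := (hder s).self_of_nhds
    rw [hloc.apply_eq_of_preconnectedSpace s 0] at h1
    have h2 := h1.fun_sub ((hasDerivAt_id s).const_mul (b 0))
    rwa [mul_one, sub_self] at h2
  have := is_const_of_deriv_eq_zero (fun s => (hd s).differentiableAt) (fun s => (hd s).deriv) t 0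
  simp at this
  linarith

/-- A continuous solution of Jensen's functional equation vanishing at `0` is linear. -/
theorem exists_eq_inner_of_jensen [CompleteSpace E] {φ : E → ℝ} (hc : Continuous φ)
    (h0 : φ 0 = 0) (h : ∀ u w, φ (u + w) + φ (u - w) = 2 * φ u) :
    ∃ v : E, ∀ u, φ u = inner ℝ v u := by
  have hadd : ∀ x y, φ (x + y) = φ x + φ y := by
    intro x y
    have h1 := h ((1 / 2 : ℝ) • (x + y)) ((1 / 2 : ℝ) • (x - y))
    have h2 := h ((1 / 2 : ℝ) • (x + y)) ((1 / 2 : ℝ) • (x + y))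
    rw [show (1 / 2 : ℝ) • (x + y) + (1 / 2 : ℝ) • (x - y) = x by module,
      show (1 / 2 : ℝ) • (x + y) - (1 / 2 : ℝ) • (x - y) = y by module] at h1
    rw [show (1 / 2 : ℝ) • (x + y) + (1 / 2 : ℝ) • (x + y) = x + y by module, sub_self, h0] at h2
    linarith
  let f : E →+ ℝ := ⟨⟨φ, h0⟩, hadd⟩
  let g : E →L[ℝ] ℝ := f.toRealLinearMap hc
  refine ⟨(InnerProductSpace.toDual ℝ E).symm g, fun u => ?_⟩
  rw [InnerProductSpace.toDual_symm_apply]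
  rfl

/-! ### Edges in the same direction have the same length -/

theorem diam_pointReflection (c : E) (X : Set E) :
    Metric.diam ((fun x => (2 : ℝ) • c - x) '' X) = Metric.diam X :=
  (Isometry.of_dist_eq fun _ _ => dist_sub_left _ _ _).diam_image X

theorem sub_mem_of_mem_convexHull {A : Set E} {K : Submodule ℝ E}
    (h : ∀ x ∈ A, ∀ y ∈ A, x - y ∈ K) {x y : E} (hx : x ∈ convexHull ℝ A)
    (hy : y ∈ convexHull ℝ A) : x - y ∈ K := by
  have h1 : vectorSpan ℝ A ≤ K := by
    refine Submodule.span_le.2 ?_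
    rintro _ ⟨x, hx, y, hy, rfl⟩
    exact h x hx y hy
  have h2 : vectorSpan ℝ (convexHull ℝ A) = vectorSpan ℝ A := by
    rw [← direction_affineSpan, affineSpan_convexHull, direction_affineSpan]
  exact h1 (h2 ▸ vsub_mem_vectorSpan ℝ hx hy)

/-- The face is the hull of the points of `S` on it, whose differences are multiples of members of
`R` orthogonal to `u`. Those members thus control the direction space of the face. -/
theorem sub_mem_of_mem_maxFace {S R : Finset E}
    (hSR : ∀ x ∈ S, ∀ y ∈ S, x ≠ y → ∃ e ∈ R, ∃ a : ℝ, x - y = a • e) {u : E}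
    {K : Submodule ℝ E} (hK : ∀ f ∈ R, inner ℝ f u = 0 → f ∈ K) {x y : E}
    (hx : x ∈ maxFace (convexHull ℝ (S : Set E)) u)
    (hy : y ∈ maxFace (convexHull ℝ (S : Set E)) u) : x - y ∈ K := by
  rw [maxFace_convexHull] at hx hy
  refine sub_mem_of_mem_convexHull (fun p hp q hq => ?_) hx hy
  by_cases hpq : p = q
  · simp [hpq]
  obtain ⟨e, he, a, hae⟩ := hSR p hp.1 q hq.1 hpq
  have ha : a ≠ 0 := by
    rintro rfl
    rw [zero_smul] at hae
    exact hpq (sub_eq_zero.1 hae)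
  have h0 : inner ℝ (p - q) u = 0 := by
    rw [inner_sub_left, inner_eq_of_mem_maxFace hp hq, sub_self]
  rw [hae, real_inner_smul_left] at h0
  rw [hae]
  exact K.smul_mem a (hK e he ((mul_eq_zero.1 h0).resolve_left ha))

theorem maxFace_pointReflection {X : Set E} {c : E} (hX : X = (fun x => (2 : ℝ) • c - x) '' X)
    (w : E) : maxFace X (-w) = (fun x => (2 : ℝ) • c - x) '' maxFace X w := by
  have hmem : ∀ x ∈ X, (2 : ℝ) • c - x ∈ X := fun x hx => hX ▸ ⟨x, hx, rfl⟩
  have aux : ∀ v, ∀ x ∈ maxFace X v, (2 : ℝ) • c - x ∈ maxFace X (-v) := by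
    rintro v x ⟨hx, h⟩
    refine ⟨hmem x hx, fun y hy => ?_⟩
    have := h _ (hmem y hy)
    simp only [inner_sub_left, inner_neg_right] at this ⊢
    linarith
  apply Set.Subset.antisymm
  · intro x hx
    refine ⟨(2 : ℝ) • c - x, ?_, by simp⟩
    simpa using aux (-w) x hx
  · rintro _ ⟨x, hx, rfl⟩
    exact aux w x hx

/-- If `X` spans the plane, the reflection exchanges the two faces. Otherwise its direction space
either lies in the line of `e`, and both faces are `X`, or meets that line only in `0`, and both
faces have at most one point. -/
theorem diam_maxFace_neg_of_sub_mem_span_pair {X : Set E} {e f w : E} (hew : inner ℝ e w = 0)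
    (hfw : inner ℝ f w ≠ 0) (hef : ∀ a : ℝ, f ≠ a • e) (he0 : e ≠ 0)
    (hX : ∀ x ∈ X, ∀ y ∈ X, x - y ∈ Submodule.span ℝ {e, f})
    (hsym : Module.finrank ℝ (vectorSpan ℝ X) = 2 →
      ∃ c : E, X = (fun x => (2 : ℝ) • c - x) '' X) :
    Metric.diam (maxFace X (-w)) = Metric.diam (maxFace X w) := by
  set V := vectorSpan ℝ X with hV
  have hVle : V ≤ Submodule.span ℝ {e, f} := by
    refine Submodule.span_le.2 ?_
    rintro _ ⟨x, hx, y, hy, rfl⟩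
    exact hX x hx y hy
  have hsub : ∀ x ∈ X, ∀ y ∈ X, x - y ∈ V := fun x hx y hy => vsub_mem_vectorSpan ℝ hx hy
  by_cases heV : e ∈ V
  · by_cases hfV : f ∈ V
    · have hVeq : V = Submodule.span ℝ {e, f} := by
        refine hVle.antisymm (Submodule.span_le.2 ?_)
        rintro x (rfl | rfl)
        exacts [heV, hfV]
      have hli : LinearIndependent ℝ ![e, f] := by
        rw [LinearIndependent.pair_iff' he0]
        exact fun a h => hef a h.symm
      have h2 : Module.finrank ℝ V = 2 := by
        rw [hVeq]
        have := finrank_span_eq_card hli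
        rwa [Matrix.range_cons, Matrix.range_cons, Matrix.range_empty, Set.union_empty,
          Set.singleton_union, Fintype.card_fin] at this
      obtain ⟨c, hc⟩ := hsym h2
      rw [maxFace_pointReflection hc, diam_pointReflection]
    · have hperp : ∀ v ∈ V, inner ℝ v w = 0 := by
        intro v hv
        obtain ⟨a, b, rfl⟩ := Submodule.mem_span_pair.1 (hVle hv)
        have hb : b = 0 := by
          by_contra hb
          apply hfV
          have h1 : b • f ∈ V := by
            have := V.sub_mem hv (V.smul_mem a heV)
            rwa [add_sub_cancel_left] at this
          have := V.smul_mem b⁻¹ h1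
          rwa [smul_smul, inv_mul_cancel₀ hb, one_smul] at this
        rw [hb, zero_smul, add_zero, real_inner_smul_left, hew, mul_zero]
      rw [maxFace_eq_self fun x hx y hy => hperp _ (hsub x hx y hy),
        maxFace_eq_self fun x hx y hy => by
          rw [inner_neg_right, hperp _ (hsub x hx y hy), neg_zero]]
  · have hss : ∀ v, inner ℝ e v = 0 → inner ℝ f v ≠ 0 → Metric.diam (maxFace X v) = 0 := by
      intro v hev hfv
      refine Metric.diam_subsingleton fun x hx y hy => ?_
      have h0 : inner ℝ (x - y) v = 0 := by
        rw [inner_sub_left, inner_eq_of_mem_maxFace hx hy, sub_self]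
      have hm := hsub x hx.1 y hy.1
      obtain ⟨a, b, hab⟩ := Submodule.mem_span_pair.1 (hVle hm)
      rw [← hab, inner_add_left, real_inner_smul_left, real_inner_smul_left, hev, mul_zero,
        zero_add] at h0
      have hb := (mul_eq_zero.1 h0).resolve_right hfv
      rw [hb, zero_smul, add_zero] at hab
      by_cases ha : a = 0
      · rw [ha, zero_smul] at hab
        exact sub_eq_zero.1 hab.symm
      · refine absurd ?_ heV
        have := V.smul_mem a⁻¹ (hab ▸ hm)
        rwa [smul_smul, inv_mul_cancel₀ ha, one_smul] at this
    rw [hss w hew hfw, hss (-w) (by simpa using hew) (by simpa using hfw)]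

theorem eventually_nhds_of_left_right {p : ℝ → Prop} {t : ℝ} (hl : ∀ᶠ s in 𝓝[<] t, p s)
    (hr : ∀ᶠ s in 𝓝[>] t, p s) (ht : p t) : ∀ᶠ s in 𝓝 t, p s := by
  rw [← nhdsNE_sup_pure, ← nhdsLT_sup_nhdsGT, eventually_sup, eventually_sup]
  exact ⟨⟨hl, hr⟩, ht⟩

theorem maxFace_maxFace_self (X : Set E) (w : E) : maxFace (maxFace X w) w = maxFace X w :=
  maxFace_eq_self fun x hx y hy => by
    rw [inner_sub_left, inner_eq_of_mem_maxFace hx hy, sub_self]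

theorem maxFace_maxFace_neg_self (X : Set E) (w : E) :
    maxFace (maxFace X (-w)) w = maxFace X (-w) :=
  maxFace_eq_self fun x hx y hy => by
    have := inner_eq_of_mem_maxFace hx hy
    simp only [inner_neg_right, neg_inj] at this
    rw [inner_sub_left, this, sub_self]

/-- Orthogonal projection to `e^⊥` is self-adjoint and kills no `v` in `T`, so the projection of a
generic vector works. -/
theorem exists_orthogonal_inner_ne_zero {e : E} (he : ‖e‖ = 1) (T : Finset E)
    (hT : ∀ v ∈ T, ∀ a : ℝ, v ≠ a • e) :
    ∃ z : E, inner ℝ e z = 0 ∧ ∀ v ∈ T, inner ℝ v z ≠ 0 := by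
  classical
  obtain ⟨z, hz⟩ := (dense_inner_ne_zero (T.image fun v => v - (inner ℝ v e : ℝ) • e) (by
    intro v' hv'
    obtain ⟨v, hv, rfl⟩ := Finset.mem_image.1 hv'
    exact sub_ne_zero.2 (hT v hv _))).nonempty
  refine ⟨z - (inner ℝ e z : ℝ) • e, ?_, fun v hv => ?_⟩
  · rw [inner_sub_right, real_inner_smul_right, real_inner_self_eq_norm_sq, he]
    ring
  · have := hz _ (Finset.mem_image_of_mem _ hv)
    rw [inner_sub_left, real_inner_smul_left] at this
    rw [inner_sub_right, real_inner_smul_right]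
    intro h
    apply this
    linarith

/-- By `hline`, members `f ≠ e` and `g` of `R` are orthogonal to the same `u + t • w` only if `g`
lies in the plane of `e` and `f`. Hence each face met on the line spans at most a plane containing
`e`. Its faces towards `-w` and `w` are the faces of `P` just before and just after `t`, and they
are equally long, so the length is locally constant. -/
theorem diam_maxFace_eq_of_line {S R : Finset E} (hR1 : ∀ e ∈ R, ‖e‖ = 1)
    (hR2 : ∀ e ∈ R, ∀ f ∈ R, ∀ a : ℝ, e = a • f → e = f)
    (hSR : ∀ x ∈ S, ∀ y ∈ S, x ≠ y → ∃ e ∈ R, ∃ a : ℝ, x - y = a • e)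
    (hsym : ∀ u, Module.finrank ℝ (vectorSpan ℝ (maxFace (convexHull ℝ (S : Set E)) u)) = 2 →
      ∃ c : E, maxFace (convexHull ℝ (S : Set E)) u =
        (fun x => (2 : ℝ) • c - x) '' maxFace (convexHull ℝ (S : Set E)) u)
    {e u w : E} (he : e ∈ R) (heu : inner ℝ e u = 0) (hew : inner ℝ e w = 0)
    (hu : ∀ f ∈ R, f ≠ e → inner ℝ f u ≠ 0)
    (hline : ∀ f ∈ R, f ≠ e → ∀ g ∈ R, g ∉ Submodule.span ℝ {e, f} →
      (inner ℝ f u * inner ℝ g w - inner ℝ g u * inner ℝ f w : ℝ) ≠ 0) (t t' : ℝ) :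
    Metric.diam (maxFace (maxFace (convexHull ℝ (S : Set E)) (u + t • w)) w) =
      Metric.diam (maxFace (maxFace (convexHull ℝ (S : Set E)) (u + t' • w)) w) := by
  set P := convexHull ℝ (S : Set E)
  have he0 : e ≠ 0 := by
    rintro rfl
    simpa using hR1 _ he
  have hneg : ∀ t : ℝ, Metric.diam (maxFace (maxFace P (u + t • w)) (-w)) =
      Metric.diam (maxFace (maxFace P (u + t • w)) w) := by
    intro t
    have hin : ∀ z : E, inner ℝ z (u + t • w) = inner ℝ z u + t * inner ℝ z w := fun z => by
      rw [inner_add_right, real_inner_smul_right]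
    by_cases hZ : ∃ f ∈ R, f ≠ e ∧ inner ℝ f (u + t • w) = 0
    · obtain ⟨f, hf, hfe, hf0⟩ := hZ
      rw [hin] at hf0
      have hfw : inner ℝ f w ≠ 0 := by
        intro h
        rw [h, mul_zero, add_zero] at hf0
        exact hu f hf hfe hf0
      refine diam_maxFace_neg_of_sub_mem_span_pair hew hfw (fun a h => hfe (hR2 f hf e he a h))
        he0 (fun x hx y hy => ?_) (hsym _)
      refine sub_mem_of_mem_maxFace hSR (fun g hg hg0 => ?_) hx hy
      by_contra hgs
      rw [hin] at hg0
      refine hline f hf hfe g hg hgs ?_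
      linear_combination inner ℝ g w * hf0 - inner ℝ f w * hg0
    · push Not at hZ
      have hK : ∀ x ∈ maxFace P (u + t • w), ∀ y ∈ maxFace P (u + t • w),
          inner ℝ (x - y) w = 0 := by
        intro x hx y hy
        have : x - y ∈ Submodule.span ℝ {e} := by
          refine sub_mem_of_mem_maxFace hSR (fun g hg hg0 => ?_) hx hy
          by_cases hge : g = e
          · rw [hge]; exact Submodule.mem_span_singleton_self e
          · exact absurd hg0 (hZ g hg hge)
        obtain ⟨a, ha⟩ := Submodule.mem_span_singleton.1 this
        rw [← ha, real_inner_smul_left, hew, mul_zero]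
      rw [maxFace_eq_self hK, maxFace_eq_self fun x hx y hy => by
        rw [inner_neg_right, hK x hx y hy, neg_zero]]
  have hloc : IsLocallyConstant fun t : ℝ => Metric.diam (maxFace (maxFace P (u + t • w)) w) := by
    rw [IsLocallyConstant.iff_eventually_eq]
    intro t
    refine eventually_nhds_of_left_right ?_ ?_ rfl
    · filter_upwards [maxFace_line_lt S u w t] with s hs
      rw [hs, maxFace_maxFace_neg_self, hneg]
    · filter_upwards [maxFace_line_gt S u w t] with s hs
      rw [hs, maxFace_maxFace_self]
  exact hloc.apply_eq_of_preconnectedSpace t t'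

/-- All edges of `conv S` in a given direction have the same length. -/
theorem diam_maxFace_eq {S R : Finset E} (hR1 : ∀ e ∈ R, ‖e‖ = 1)
    (hR2 : ∀ e ∈ R, ∀ f ∈ R, ∀ a : ℝ, e = a • f → e = f)
    (hSR : ∀ x ∈ S, ∀ y ∈ S, x ≠ y → ∃ e ∈ R, ∃ a : ℝ, x - y = a • e)
    (hsym : ∀ u, Module.finrank ℝ (vectorSpan ℝ (maxFace (convexHull ℝ (S : Set E)) u)) = 2 →
      ∃ c : E, maxFace (convexHull ℝ (S : Set E)) u =
        (fun x => (2 : ℝ) • c - x) '' maxFace (convexHull ℝ (S : Set E)) u)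
    {e u u' : E} (he : e ∈ R) (heu : inner ℝ e u = 0) (heu' : inner ℝ e u' = 0)
    (hu : ∀ f ∈ R, f ≠ e → inner ℝ f u ≠ 0) (hu' : ∀ f ∈ R, f ≠ e → inner ℝ f u' ≠ 0) :
    Metric.diam (maxFace (convexHull ℝ (S : Set E)) u) =
      Metric.diam (maxFace (convexHull ℝ (S : Set E)) u') := by
  classical
  set P := convexHull ℝ (S : Set E) with hP
  have hspan : ∀ v, (∀ f ∈ R, f ≠ e → inner ℝ f v ≠ 0) → ∀ z, inner ℝ e z = 0 →
      maxFace (maxFace P v) z = maxFace P v := by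
    intro v hv z hz
    refine maxFace_eq_self fun x hx y hy => ?_
    have : x - y ∈ Submodule.span ℝ {e} := by
      refine sub_mem_of_mem_maxFace hSR (fun g hg hg0 => ?_) hx hy
      by_cases hge : g = e
      · rw [hge]; exact Submodule.mem_span_singleton_self e
      · exact absurd hg0 (hv g hg hge)
    obtain ⟨a, ha⟩ := Submodule.mem_span_singleton.1 this
    rw [← ha, real_inner_smul_left, hz, mul_zero]
  -- Pairing these vectors with `w` gives the determinants that must not vanish along the line; none
  -- is parallel to `e`.
  let T := ((R ×ˢ R).filter fun p : E × E => p.1 ≠ e ∧ p.2 ∉ Submodule.span ℝ {e, p.1}).image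
    fun p => (inner ℝ p.1 u : ℝ) • p.2 - (inner ℝ p.2 u : ℝ) • p.1
  have hT : ∀ v ∈ T, ∀ a : ℝ, v ≠ a • e := by
    intro v hv a hva
    simp only [T, Finset.mem_image, Finset.mem_filter, Finset.mem_product] at hv
    obtain ⟨⟨f, g⟩, ⟨⟨hf, hg⟩, hfe, hgs⟩, rfl⟩ := hv
    apply hgs
    have h0 := hu f hf hfe
    dsimp only at hva h0
    have : g = (inner ℝ f u : ℝ)⁻¹ • (a • e + (inner ℝ g u : ℝ) • f) := by
      rw [← hva, sub_add_cancel, smul_smul, inv_mul_cancel₀ h0, one_smul]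
    rw [this]
    exact Submodule.smul_mem _ _ (Submodule.add_mem _
      (Submodule.smul_mem _ _ (Submodule.subset_span (by simp)))
      (Submodule.smul_mem _ _ (Submodule.subset_span (by simp))))
  obtain ⟨z, hez, hz⟩ := exists_orthogonal_inner_ne_zero (hR1 e he) T hT
  -- The direction `u' - u` itself may be non-generic. The endpoint is moved to `u' + ε • z` with `z
  -- ⟂ e`: each `v` excludes one value of `ε`, and a small `ε` leaves the face at `u'` unchanged.
  have h1 : ∀ᶠ ε : ℝ in 𝓝[>] 0, ∀ v ∈ T, inner ℝ v (u' + ε • z - u) ≠ 0 := by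
    rw [Finset.eventually_all]
    intro v hv
    have : ∀ᶠ ε in 𝓝[>] (0 : ℝ), ε ≠ - inner ℝ v (u' - u) / inner ℝ v z :=
      nhdsWithin_mono 0 (fun x (hx : 0 < x) => hx.ne')
        (nhdsNE_le_cofinite 0 ((Set.finite_singleton _).eventually_cofinite_notMem))
    filter_upwards [this] with ε hε h0
    apply hε
    have := hz v hv
    simp only [inner_sub_right, inner_add_right, real_inner_smul_right] at h0 ⊢
    field_simp
    linarith
  obtain ⟨ε, hε, hface⟩ := (h1.and (maxFace_add_smul S u' z)).exists
  have key := diam_maxFace_eq_of_line hR1 hR2 hSR hsym (w := u' + ε • z - u) he heu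
    (by rw [inner_sub_right, inner_add_right, real_inner_smul_right, heu, heu', hez]; ring) hu
    (fun f hf hfe g hg hgs => by
      have := hε ((inner ℝ f u : ℝ) • g - (inner ℝ g u : ℝ) • f) (Finset.mem_image.2
        ⟨(f, g), Finset.mem_filter.2 ⟨Finset.mem_product.2 ⟨hf, hg⟩, hfe, hgs⟩, rfl⟩)
      rwa [inner_sub_left, real_inner_smul_left, real_inner_smul_left] at this) 0 1
  have hew : inner ℝ e (u' + ε • z - u) = 0 := by
    rw [inner_sub_right, inner_add_right, real_inner_smul_right, heu, heu', hez]; ring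
  rw [zero_smul, add_zero, one_smul, add_sub_cancel, ← hP, hface, hspan u hu _ hew,
    hspan u' hu' z hez, hspan u' hu' _ hew] at key
  exact key

/-! ### Kinks of the support function along generic lines -/

/-- Here `b` is the mean of the two one-sided slopes at `t`, and the coefficient of `|t' - t|` is
half their jump. -/
theorem exists_abs_line_expansion (p q t : ℝ) :
    ∃ b, ∀ᶠ t' in 𝓝 t, |p + t' * q| =
      |p + t * q| + b * (t' - t) + (if p + t * q = 0 then |q| else 0) * |t' - t| := by
  have hc : ContinuousAt (fun t' : ℝ => p + t' * q) t := by fun_prop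
  rcases lt_trichotomy (p + t * q) 0 with h | h | h
  · refine ⟨-q, ?_⟩
    filter_upwards [hc.eventually_lt continuousAt_const h] with t' ht'
    rw [if_neg h.ne, abs_of_neg ht', abs_of_neg h]
    ring
  · refine ⟨0, Eventually.of_forall fun t' => ?_⟩
    rw [if_pos h, h, show p + t' * q = q * (t' - t) by linear_combination h, abs_mul]
    simp
  · refine ⟨q, ?_⟩
    filter_upwards [continuousAt_const.eventually_lt hc h] with t' ht'
    rw [if_neg h.ne', abs_of_pos ht', abs_of_pos h]
    ring

/-- The support function of the convex hull of a nonempty finite set. -/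
noncomputable def supportFn (S : Finset E) (hS : S.Nonempty) (u : E) : ℝ :=
  S.sup' hS fun s => inner ℝ s u

theorem continuous_supportFn (S : Finset E) (hS : S.Nonempty) : Continuous (supportFn S hS) :=
  Continuous.finset_sup'_apply hS fun _ _ => by fun_prop

theorem inner_le_supportFn {S : Finset E} (hS : S.Nonempty) {x : E}
    (hx : x ∈ convexHull ℝ (S : Set E)) (u : E) : inner ℝ x u ≤ supportFn S hS u :=
  inner_le_of_mem_convexHull (fun _ hy => Finset.le_sup' (fun s => inner ℝ s u) hy) hx

theorem supportFn_eq {S : Finset E} (hS : S.Nonempty) {x u : E}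
    (hx : x ∈ maxFace (convexHull ℝ (S : Set E)) u) : supportFn S hS u = inner ℝ x u :=
  le_antisymm (Finset.sup'_le _ _ fun _ hs => hx.2 _ (subset_convexHull ℝ _ hs))
    (inner_le_supportFn hS hx.1 u)

theorem isCompact_maxFace {X : Set E} (hX : IsCompact X) (u : E) : IsCompact (maxFace X u) := by
  have : maxFace X u = X ∩ ⋂ y ∈ X, {x | inner ℝ y u ≤ inner ℝ x u} := by
    ext x
    simp [maxFace]
  rw [this]
  refine hX.inter_right (isClosed_biInter fun y _ => isClosed_le ?_ ?_) <;> fun_prop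

/-- At most one `e` in `R` is orthogonal to `u`. If there is one, the face is a segment parallel to
`e` with ends `x` and `y`, or a point, and its length is `c e`; if there is none, it is a point. So
at most one summand is nonzero. -/
theorem inner_sub_of_opposite_maxFaces {S R : Finset E} (hR1 : ∀ e ∈ R, ‖e‖ = 1)
    (hSR : ∀ x ∈ S, ∀ y ∈ S, x ≠ y → ∃ e ∈ R, ∃ a : ℝ, x - y = a • e) {c : E → ℝ}
    (hc : ∀ e ∈ R, ∀ u, inner ℝ e u = 0 → (∀ f ∈ R, f ≠ e → inner ℝ f u ≠ 0) →
      Metric.diam (maxFace (convexHull ℝ (S : Set E)) u) = c e)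
    {u w x y : E} (huw : ∀ e ∈ R, ∀ f ∈ R, inner ℝ e u = 0 → inner ℝ f u = 0 → e = f)
    (hw : ∀ e ∈ R, inner ℝ e u = 0 → inner ℝ e w ≠ 0)
    (hx : x ∈ maxFace (maxFace (convexHull ℝ (S : Set E)) u) w)
    (hy : y ∈ maxFace (maxFace (convexHull ℝ (S : Set E)) u) (-w)) :
    inner ℝ (x - y) w = ∑ e ∈ R, c e * (if inner ℝ e u = 0 then |inner ℝ e w| else 0 : ℝ) := by
  set P := convexHull ℝ (S : Set E) with hP
  by_cases hZ : ∃ e ∈ R, inner ℝ e u = 0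
  · obtain ⟨e, he, heu⟩ := hZ
    rw [Finset.sum_eq_single_of_mem e he fun f hf hfe => by
      rw [if_neg fun hfu => hfe (huw f hf e he hfu heu), mul_zero], if_pos heu]
    have hew := hw e he heu
    have hmem : ∀ p ∈ maxFace P u, ∀ q ∈ maxFace P u, ∃ a : ℝ, p - q = a • e := by
      intro p hp q hq
      have : p - q ∈ Submodule.span ℝ {e} := by
        refine sub_mem_of_mem_maxFace hSR (fun g hg hg0 => ?_) hp hq
        rw [huw g hg e he hg0 heu]
        exact Submodule.mem_span_singleton_self e
      obtain ⟨a, ha⟩ := Submodule.mem_span_singleton.1 this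
      exact ⟨a, ha.symm⟩
    have hle : ∀ p ∈ maxFace P u, ∀ q ∈ maxFace P u, inner ℝ (p - q) w ≤ inner ℝ (x - y) w := by
      intro p hp q hq
      have h1 := hx.2 p hp
      have h2 := hy.2 q hq
      simp only [inner_neg_right] at h2
      rw [inner_sub_left, inner_sub_left]
      linarith
    have hdist : ∀ p ∈ maxFace P u, ∀ q ∈ maxFace P u,
        |inner ℝ (p - q) w| = dist p q * |inner ℝ e w| := by
      intro p hp q hq
      obtain ⟨a, ha⟩ := hmem p hp q hq
      rw [dist_eq_norm, ha, real_inner_smul_left, norm_smul, hR1 e he, mul_one, abs_mul,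
        Real.norm_eq_abs]
    have hnn : 0 ≤ inner ℝ (x - y) w := by simpa using hle x hx.1 x hx.1
    have hxy := hdist x hx.1 y hy.1
    rw [abs_of_nonneg hnn] at hxy
    have hdiam : Metric.diam (maxFace P u) = dist x y := by
      apply le_antisymm
      · refine Metric.diam_le_of_forall_dist_le dist_nonneg fun p hp q hq => ?_
        have h1 : |inner ℝ (p - q) w| ≤ inner ℝ (x - y) w := by
          refine abs_le'.2 ⟨hle p hp q hq, ?_⟩
          rw [← inner_neg_left, neg_sub]
          exact hle q hq p hp
        rw [hdist p hp q hq, hxy] at h1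
        exact le_of_mul_le_mul_right h1 (abs_pos.2 hew)
      · refine Metric.dist_le_diam_of_mem ?_ hx.1 hy.1
        exact (S.finite_toSet.isCompact_convexHull ℝ).isBounded.subset (maxFace_subset _ _)
    rw [hxy, ← hdiam, hc e he u heu fun f hf hfe hfu => hfe (huw f hf e he hfu heu)]
  · push Not at hZ
    have hxy : x - y ∈ (⊥ : Submodule ℝ E) :=
      sub_mem_of_mem_maxFace hSR (fun g hg hg0 => absurd hg0 (hZ g hg)) hx.1 hy.1
    rw [(Submodule.mem_bot ℝ).1 hxy, inner_zero_left, Finset.sum_eq_zero]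
    intro e he
    rw [if_neg (hZ e he), mul_zero]

/-- The one-sided slopes of the support function at `t` are `⟪y, w⟫` and `⟪x, w⟫`, where `x` and `y`
lie on the faces towards `w` and `-w` of the face at `t`. Half their difference is the coefficient
of `|t' - t|`, and it cancels against the kink of the sum. -/
theorem supportFn_sub_abs_locally_affine {S R : Finset E} (hS : S.Nonempty)
    (hR1 : ∀ e ∈ R, ‖e‖ = 1)
    (hSR : ∀ x ∈ S, ∀ y ∈ S, x ≠ y → ∃ e ∈ R, ∃ a : ℝ, x - y = a • e) {c : E → ℝ}
    (hc : ∀ e ∈ R, ∀ u, inner ℝ e u = 0 → (∀ f ∈ R, f ≠ e → inner ℝ f u ≠ 0) →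
      Metric.diam (maxFace (convexHull ℝ (S : Set E)) u) = c e)
    {u w : E} {t : ℝ}
    (huw : ∀ e ∈ R, ∀ f ∈ R, inner ℝ e (u + t • w) = 0 → inner ℝ f (u + t • w) = 0 → e = f)
    (hw : ∀ e ∈ R, inner ℝ e (u + t • w) = 0 → inner ℝ e w ≠ 0) {φ : E → ℝ}
    (hφ : ∀ u, φ u = supportFn S hS u - 1 / 2 * ∑ e ∈ R, c e * |inner ℝ e u|) :
    ∃ b, ∀ᶠ t' in 𝓝 t, φ (u + t' • w) = φ (u + t • w) + b * (t' - t) := by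
  set P := convexHull ℝ (S : Set E) with hP
  have hPc : IsCompact P := S.finite_toSet.isCompact_convexHull ℝ
  have hF := isCompact_maxFace hPc (u + t • w)
  have hFne := maxFace_nonempty hPc (convexHull_nonempty_iff.2 (Finset.coe_nonempty.2 hS))
    (u + t • w)
  obtain ⟨x, hx⟩ := maxFace_nonempty hF hFne w
  obtain ⟨y, hy⟩ := maxFace_nonempty hF hFne (-w)
  have hjump := inner_sub_of_opposite_maxFaces hR1 hSR hc huw hw hx hy
  rw [inner_sub_left] at hjump
  have hin : ∀ (t : ℝ) (z : E), inner ℝ z (u + t • w) = inner ℝ z u + t * inner ℝ z w :=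
    fun t z => by rw [inner_add_right, real_inner_smul_right]
  have hxy := inner_eq_of_mem_maxFace hx.1 hy.1
  have hh : ∀ᶠ t' in 𝓝 t, supportFn S hS (u + t' • w) = supportFn S hS (u + t • w) +
      (inner ℝ x w + inner ℝ y w) / 2 * (t' - t) +
      (inner ℝ x w - inner ℝ y w) / 2 * |t' - t| := by
    refine eventually_nhds_of_left_right ?_ ?_ (by simp)
    · filter_upwards [maxFace_line_lt S u w t, self_mem_nhdsWithin] with t' ht' (hlt : t' < t)
      rw [← ht'] at hy
      rw [supportFn_eq hS hy, supportFn_eq hS hx.1, hxy, abs_of_neg (sub_neg.2 hlt), hin, hin]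
      ring
    · filter_upwards [maxFace_line_gt S u w t, self_mem_nhdsWithin] with t' ht' (hlt : t < t')
      rw [← ht'] at hx
      rw [supportFn_eq hS hx, supportFn_eq hS hy.1, ← hxy, abs_of_pos (sub_pos.2 hlt), hin, hin]
      ring
  choose b hb using fun e : E => exists_abs_line_expansion (inner ℝ e u) (inner ℝ e w) t
  have hb' : ∀ᶠ t' in 𝓝 t, ∀ e ∈ R, _ := (Finset.eventually_all R).2 fun e _ => hb e
  refine ⟨(inner ℝ x w + inner ℝ y w) / 2 - 1 / 2 * ∑ e ∈ R, c e * b e, ?_⟩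
  filter_upwards [hh, hb'] with t' h1 h2
  have h3 : ∑ e ∈ R, c e * |inner ℝ e (u + t' • w)| =
      ∑ e ∈ R, c e * |inner ℝ e (u + t • w)| + (∑ e ∈ R, c e * b e) * (t' - t) +
      (∑ e ∈ R, c e * (if inner ℝ e (u + t • w) = 0 then |inner ℝ e w| else 0 : ℝ)) *
        |t' - t| := by
    rw [Finset.sum_mul, Finset.sum_mul, ← Finset.sum_add_distrib, ← Finset.sum_add_distrib]
    refine Finset.sum_congr rfl fun e he => ?_
    rw [hin t', hin t, h2 e he]
    ring
  rw [hφ, hφ, h1, h3, ← hjump]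
  ring

/-- If `u` avoids all hyperplanes `e^⊥`, a generic line through `u` crosses them transversally and
one at a time, so `φ` is affine on it. The equation is closed in `w` and in `u`, so density extends
it to all `w`, then to all `u`. -/
theorem jensen_of_line {R : Finset E} (hR1 : ∀ e ∈ R, ‖e‖ = 1)
    (hR2 : ∀ e ∈ R, ∀ f ∈ R, ∀ a : ℝ, e = a • f → e = f) {φ : E → ℝ} (hφ : Continuous φ)
    (h : ∀ (u w : E) (t : ℝ),
      (∀ e ∈ R, ∀ f ∈ R, inner ℝ e (u + t • w) = 0 → inner ℝ f (u + t • w) = 0 → e = f) →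
      (∀ e ∈ R, inner ℝ e (u + t • w) = 0 → inner ℝ e w ≠ 0) →
      ∃ b, ∀ᶠ t' in 𝓝 t, φ (u + t' • w) = φ (u + t • w) + b * (t' - t)) (u w : E) :
    φ (u + w) + φ (u - w) = 2 * φ u := by
  classical
  have hne : ∀ e ∈ R, e ≠ 0 := by
    rintro e he rfl
    simpa using hR1 _ he
  have hgen : ∀ u, (∀ e ∈ R, inner ℝ e u ≠ 0) → ∀ w, φ (u + w) + φ (u - w) = 2 * φ u := by
    intro u hu
    -- If `e` and `f` were orthogonal to the same point of the line, `w` would be orthogonal to the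
    -- corresponding vector.
    let T := ((R ×ˢ R).filter fun p : E × E => p.1 ≠ p.2).image
      fun p => (inner ℝ p.1 u : ℝ) • p.2 - (inner ℝ p.2 u : ℝ) • p.1
    have hT : ∀ v ∈ T, v ≠ 0 := by
      intro v hv hv0
      simp only [T, Finset.mem_image, Finset.mem_filter, Finset.mem_product] at hv
      obtain ⟨⟨e, f⟩, ⟨⟨he, hf⟩, hef⟩, rfl⟩ := hv
      refine hef (hR2 f hf e he ((inner ℝ e u)⁻¹ * inner ℝ f u) ?_).symm
      dsimp only at hv0 he
      rw [mul_smul, ← sub_eq_zero.1 hv0, smul_smul, inv_mul_cancel₀ (hu e he), one_smul]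
    have hclosed : IsClosed {w | φ (u + w) + φ (u - w) = 2 * φ u} :=
      isClosed_eq (by fun_prop) (by fun_prop)
    have hsub : {w : E | ∀ v ∈ T, inner ℝ v w ≠ 0} ⊆ {w | φ (u + w) + φ (u - w) = 2 * φ u} := by
      intro w hw
      have hin : ∀ (t : ℝ) (z : E), inner ℝ z (u + t • w) = inner ℝ z u + t * inner ℝ z w :=
        fun t z => by rw [inner_add_right, real_inner_smul_right]
      obtain ⟨b, hb⟩ := affine_of_locally_affine (ψ := fun t => φ (u + t • w)) fun t => by
        refine h u w t (fun e he f hf he0 hf0 => ?_) fun e he he0 hew => ?_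
        · by_contra hef
          rw [hin] at he0 hf0
          refine hw ((inner ℝ e u : ℝ) • f - (inner ℝ f u : ℝ) • e) (Finset.mem_image.2
            ⟨(e, f), Finset.mem_filter.2 ⟨Finset.mem_product.2 ⟨he, hf⟩, hef⟩, rfl⟩) ?_
          rw [inner_sub_left, real_inner_smul_left, real_inner_smul_left]
          linear_combination inner ℝ f w * he0 - inner ℝ e w * hf0
        · rw [hin, hew, mul_zero, add_zero] at he0
          exact hu e he he0
      have h1 := hb 1
      have h2 := hb (-1)
      simp only [one_smul, neg_smul, ← sub_eq_add_neg, zero_smul, add_zero] at h1 h2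
      change φ (u + w) + φ (u - w) = 2 * φ u
      rw [h1, h2]
      ring
    intro w
    exact hclosed.closure_subset_iff.2 hsub (dense_inner_ne_zero T hT w)
  have hclosed : IsClosed {u | φ (u + w) + φ (u - w) = 2 * φ u} :=
    isClosed_eq (by fun_prop) (by fun_prop)
  exact hclosed.closure_subset_iff.2 (fun u hu => hgen u hu w) (dense_inner_ne_zero R hne u)

theorem exists_supportFn_eq [CompleteSpace E] {S : Finset E} (hS : S.Nonempty)
    (hsym : ∀ u, Module.finrank ℝ (vectorSpan ℝ (maxFace (convexHull ℝ (S : Set E)) u)) = 2 →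
      ∃ c : E, maxFace (convexHull ℝ (S : Set E)) u =
        (fun x => (2 : ℝ) • c - x) '' maxFace (convexHull ℝ (S : Set E)) u) :
    ∃ (R : Finset E) (c : E → ℝ) (v : E), (∀ e, 0 ≤ c e) ∧
      ∀ u, supportFn S hS u = inner ℝ v u + 1 / 2 * ∑ e ∈ R, c e * |inner ℝ e u| := by
  classical
  obtain ⟨R, hR1, hR2, hR3⟩ := exists_direction_representatives
    ((S ×ˢ S).image fun p : E × E => p.1 - p.2)
  have hSR : ∀ x ∈ S, ∀ y ∈ S, x ≠ y → ∃ e ∈ R, ∃ a : ℝ, x - y = a • e := fun x hx y hy hxy =>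
    hR3 _ (Finset.mem_image.2 ⟨(x, y), Finset.mem_product.2 ⟨hx, hy⟩, rfl⟩) (sub_ne_zero.2 hxy)
  have hex : ∀ e : E, ∃ c : ℝ, 0 ≤ c ∧ (e ∈ R → ∀ u, inner ℝ e u = 0 →
      (∀ f ∈ R, f ≠ e → inner ℝ f u ≠ 0) →
      Metric.diam (maxFace (convexHull ℝ (S : Set E)) u) = c) := by
    intro e
    by_cases h : ∃ u, inner ℝ e u = 0 ∧ ∀ f ∈ R, f ≠ e → inner ℝ f u ≠ 0
    · obtain ⟨u₀, h0, hg⟩ := h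
      exact ⟨_, Metric.diam_nonneg, fun he u hu hgu =>
        diam_maxFace_eq hR1 hR2 hSR hsym he hu h0 hgu hg⟩
    -- Without a generic `u` the condition on the length is vacuous and any nonnegative value would
    -- do.
    · exact ⟨0, le_rfl, fun _ u hu hgu => absurd ⟨u, hu, hgu⟩ h⟩
  choose c hc0 hc using hex
  let φ : E → ℝ := fun u => supportFn S hS u - 1 / 2 * ∑ e ∈ R, c e * |inner ℝ e u|
  have hcont : Continuous φ := by
    have := continuous_supportFn S hS
    fun_prop
  obtain ⟨v, hv⟩ := exists_eq_inner_of_jensen hcont (by simp [φ, supportFn])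
    (jensen_of_line hR1 hR2 hcont fun u w t huw hw =>
      supportFn_sub_abs_locally_affine hS hR1 hSR hc huw hw fun _ => rfl)
  refine ⟨R, c, v, hc0, fun u => ?_⟩
  rw [← hv]
  simp [φ]

/-! ### Recovering the zonotope from its support function -/

/-- A closed convex set contains every set whose support function is at most its own. -/
theorem subset_of_forall_inner_le [CompleteSpace E] {P Q : Set E} (hQ : Convex ℝ Q)
    (hQc : IsClosed Q) (h : ∀ u, ∀ x ∈ P, ∃ y ∈ Q, inner ℝ x u ≤ inner ℝ y u) : P ⊆ Q := by
  intro x hx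
  by_contra hxQ
  obtain ⟨f, s, hf, hs⟩ := geometric_hahn_banach_closed_point hQ hQc hxQ
  obtain ⟨y, hy, hxy⟩ := h ((InnerProductSpace.toDual ℝ E).symm f) x hx
  rw [real_inner_comm, InnerProductSpace.toDual_symm_apply, real_inner_comm,
    InnerProductSpace.toDual_symm_apply] at hxy
  linarith [hf y hy]

theorem convex_zonotopeGeneratedBy {n k : ℕ} (a : Fin k → EuclideanSpace ℝ (Fin n)) :
    Convex ℝ (zonotopeGeneratedBy a) := by
  rintro _ ⟨s, hs, rfl⟩ _ ⟨t, ht, rfl⟩ p q hp hq hpq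
  refine ⟨fun i => p * s i + q * t i, fun i => ⟨?_, ?_⟩, ?_⟩
  · have := (hs i).1
    have := (ht i).1
    positivity
  · calc p * s i + q * t i ≤ p * 1 + q * 1 := by
          gcongr
          exacts [(hs i).2, (ht i).2]
      _ = 1 := by linarith
  · simp only [Finset.smul_sum, ← Finset.sum_add_distrib, add_smul, smul_smul]

theorem isCompact_zonotopeGeneratedBy {n k : ℕ} (a : Fin k → EuclideanSpace ℝ (Fin n)) :
    IsCompact (zonotopeGeneratedBy a) := by
  have h : zonotopeGeneratedBy a =
      (fun t : Fin k → ℝ => ∑ i, t i • a i) '' Set.pi Set.univ fun _ => Set.Icc 0 1 := by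
    ext x
    constructor
    · rintro ⟨t, ht, rfl⟩
      exact ⟨t, fun i _ => ht i, rfl⟩
    · rintro ⟨t, ht, rfl⟩
      exact ⟨t, fun i => ht i trivial, rfl⟩
  rw [h]
  exact (isCompact_univ_pi fun _ => isCompact_Icc).image (by fun_prop)

theorem inner_le_of_mem_zonotopeGeneratedBy {n k : ℕ} {a : Fin k → EuclideanSpace ℝ (Fin n)}
    {x : EuclideanSpace ℝ (Fin n)} (hx : x ∈ zonotopeGeneratedBy a)
    (u : EuclideanSpace ℝ (Fin n)) : inner ℝ x u ≤ ∑ i, max (inner ℝ (a i) u) 0 := by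
  obtain ⟨t, ht, rfl⟩ := hx
  rw [sum_inner]
  refine Finset.sum_le_sum fun i _ => ?_
  rw [real_inner_smul_left]
  calc t i * inner ℝ (a i) u ≤ t i * max (inner ℝ (a i) u) 0 :=
        mul_le_mul_of_nonneg_left (le_max_left _ _) (ht i).1
    _ ≤ 1 * max (inner ℝ (a i) u) 0 := mul_le_mul_of_nonneg_right (ht i).2 (le_max_right _ _)
    _ = _ := one_mul _

theorem exists_mem_zonotopeGeneratedBy_inner_eq {n k : ℕ} (a : Fin k → EuclideanSpace ℝ (Fin n))
    (u : EuclideanSpace ℝ (Fin n)) :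
    ∃ x ∈ zonotopeGeneratedBy a, inner ℝ x u = ∑ i, max (inner ℝ (a i) u) 0 := by
  classical
  refine ⟨_, ⟨fun i => if 0 ≤ inner ℝ (a i) u then 1 else 0, fun i => ?_, rfl⟩, ?_⟩
  · dsimp only
    split_ifs <;> norm_num
  · rw [sum_inner]
    refine Finset.sum_congr rfl fun i _ => ?_
    dsimp only
    split_ifs with h
    · rw [one_smul, max_eq_left h]
    · rw [zero_smul, inner_zero_left, max_eq_right (not_le.1 h).le]

theorem eq_add_zonotope_of_supportFn_eq {n k : ℕ} {S : Finset (EuclideanSpace ℝ (Fin n))}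
    (hS : S.Nonempty) (a : Fin k → EuclideanSpace ℝ (Fin n)) (v : EuclideanSpace ℝ (Fin n))
    (h : ∀ u, supportFn S hS u = inner ℝ v u + ∑ i, max (inner ℝ (a i) u) 0) :
    convexHull ℝ (S : Set (EuclideanSpace ℝ (Fin n))) =
      {y | ∃ x ∈ zonotopeGeneratedBy a, y = v + x} := by
  have himage : {y | ∃ x ∈ zonotopeGeneratedBy a, y = v + x} =
      (fun x => v + x) '' zonotopeGeneratedBy a := by
    ext y
    exact exists_congr fun x => and_congr_right fun _ => eq_comm
  have hP : IsCompact (convexHull ℝ (S : Set (EuclideanSpace ℝ (Fin n)))) :=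
    S.finite_toSet.isCompact_convexHull ℝ
  apply Set.Subset.antisymm
  · refine subset_of_forall_inner_le ?_ ?_ ?_
    · rw [himage]
      exact (convex_zonotopeGeneratedBy a).translate v
    · rw [himage]
      exact ((isCompact_zonotopeGeneratedBy a).image (by fun_prop)).isClosed
    · intro u x hx
      obtain ⟨z, hz, hzu⟩ := exists_mem_zonotopeGeneratedBy_inner_eq a u
      refine ⟨v + z, ⟨z, hz, rfl⟩, ?_⟩
      rw [inner_add_left, hzu, ← h u]
      exact inner_le_supportFn hS hx u
  · refine subset_of_forall_inner_le (convex_convexHull ℝ _) hP.isClosed ?_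
    rintro u _ ⟨z, hz, rfl⟩
    obtain ⟨x, hx⟩ := maxFace_nonempty hP (convexHull_nonempty_iff.2 (Finset.coe_nonempty.2 hS)) u
    refine ⟨x, hx.1, ?_⟩
    rw [← supportFn_eq hS hx, h u, inner_add_left]
    gcongr
    exact inner_le_of_mem_zonotopeGeneratedBy hz u

theorem proposition1p6 (n m : ℕ) (P : Set (EuclideanSpace ℝ (Fin n)))
    (hP : IsConvexPolytope P) (hdim : affineDim P = m)
    (hsym : ∀ F : Set (EuclideanSpace ℝ (Fin n)), IsFaceOfDim 2 P F → IsCentrallySymmetric F) :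
    IsZonotope P := by
  obtain ⟨S, hfin, hne, rfl⟩ := hP
  lift S to Finset (EuclideanSpace ℝ (Fin n)) using hfin
  have hS : S.Nonempty := by simpa using hne
  obtain ⟨R, c, v, hc, h⟩ := exists_supportFn_eq hS fun u hu => by
    obtain ⟨z, hz⟩ := hsym (maxFace (convexHull ℝ (S : Set _)) u)
      ⟨maxFace_nonempty (S.finite_toSet.isCompact_convexHull ℝ)
        (convexHull_nonempty_iff.2 hne) u,
        fun _ => ⟨innerSL ℝ u, by
          ext x
          simp [maxFace, real_inner_comm]⟩, hu⟩
    refine ⟨z, hz.trans ?_⟩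
    ext y
    exact exists_congr fun x => and_congr_right fun _ => eq_comm
  let a : Fin R.card → EuclideanSpace ℝ (Fin n) := fun i =>
    c (R.equivFin.symm i) • (R.equivFin.symm i : EuclideanSpace ℝ (Fin n))
  -- Since `|s| / 2 = max s 0 - s / 2`, the summands are segments of direction `e` and length `c e`
  -- centred at the origin; the translation makes each start at `0`.
  refine ⟨R.card, a, v - (1 / 2 : ℝ) • ∑ e ∈ R, c e • e,
    eq_add_zonotope_of_supportFn_eq hS a _ fun u => ?_⟩
  have hsum : ∑ i, max (inner ℝ (a i) u) 0 = ∑ e ∈ R, max (inner ℝ (c e • e) u) 0 := by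
    rw [← Finset.sum_coe_sort R]
    exact Equiv.sum_comp R.equivFin.symm fun e : R =>
      max (inner ℝ (c e • (e : EuclideanSpace ℝ (Fin n))) u) 0
  rw [h, hsum, inner_sub_left, real_inner_smul_left, sum_inner, sub_add, Finset.mul_sum,
    Finset.mul_sum, ← Finset.sum_sub_distrib, sub_eq_add_neg, ← Finset.sum_neg_distrib]
  congr 1
  refine Finset.sum_congr rfl fun e _ => ?_
  rw [real_inner_smul_left]
  rcases le_total 0 (inner ℝ e u) with h0 | h0
  · rw [abs_of_nonneg h0, max_eq_left (mul_nonneg (hc e) h0)]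
    ring
  · rw [abs_of_nonpos h0, max_eq_right (mul_nonpos_of_nonneg_of_nonpos (hc e) h0)]
    ring
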